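/- Let $\mathcal{B}$ be a simple body: a $3$-dimensional smooth manifold with a reference configuration (a smooth embedding) $\phi_0:\mathcal{B}\to\mathbb{R}^3$ and a mechanical response, that is, a differentiable map $W:\Pi^1(\mathcal{B},\mathcal{B})\to V$ into a normed real vector space $V$ (for example a finite-dimensional one), where $\Pi^1(\mathcal{B},\mathcal{B})$ is the manifold of all linear isomorphisms $L:T_X\mathcal{B}\to T_Y\mathcal{B}$, $X,Y\in\mathcal{B}$ (the $1$-jets of local diffeomorphisms of $\mathcal{B}$), such that $W$ does not depend on the final point with respect to $\phi_0$: $$W(L)=W\big((d\phi_0)_Z^{-1}\circ (d\phi_0)_Y\circ L\big)\qquad\text{for all } X,Y,Z\in\mathcal{B}\text{ and all linear isomorphisms } L:T_X\mathcal{B}\to T_Y\mathcal{B}.$$ For $X\in\mathcal{B}$ let $\Pi^1(\mathcal{B},\mathcal{B})_X^X$ be the isotropy group at $X$, i.e. the group of all linear automorphisms of $T_X\mathcal{B}$, with the topology induced from $\Pi^1(\mathcal{B},\mathcal{B})$ and the matrix coordinates in a chart at $X$; and let $\Omega(\mathcal{B})_X^X$ be the group of material symmetries at $X$, i.e. of all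 $P\in\Pi^1(\mathcal{B},\mathcal{B})_X^X$ such that $W(F\circ P)=W(F)$ for all $Z\in\mathcal{B}$ and all linear isomorphisms $F:T_X\mathcal{B}\to T_Z\mathcal{B}$. Then, for every $X\in\mathcal{B}$, the isotropy group $\Pi^1(\mathcal{B},\mathcal{B})_X^X$ is a Lie group isomorphic to $GL(3,\mathbb{R})$ (as a Lie group), $\Omega(\mathcal{B})_X^X$ is a closed subgroup of it, and $\Omega(\mathcal{B})_X^X$ is a Lie subgroup of it: with the subspace topology, it has a smooth structure for which it is a Lie group and its inclusion into $\Pi^1(\mathcal{B},\mathcal{B})_X^X$ is a smooth embedding. -/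

import Mathlib

open scoped Manifold ContDiff Topology Bundle

noncomputable section

namespace SimpleBody

/-- The Euclidean space `ℝ³`. -/
abbrev E3 : Type := EuclideanSpace ℝ (Fin 3)

section OneJets

variable (B : Type*) [TopologicalSpace B] [ChartedSpace E3 B] [IsManifold 𝓘(ℝ, E3) ∞ B]

/-- The pullback of the tangent bundle `T B` to `B × B` by the first projection. -/
abbrev SourceTangent : B × B → Type :=
  (ContMDiffMap.fst : C^∞⟮𝓘(ℝ, E3).prod 𝓘(ℝ, E3), B × B; 𝓘(ℝ, E3), B⟯) *ᵖ
    (TangentSpace 𝓘(ℝ, E3) : B → Type)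

/-- The pullback of the tangent bundle `T B` to `B × B` by the second projection. -/
abbrev TargetTangent : B × B → Type :=
  (ContMDiffMap.snd : C^∞⟮𝓘(ℝ, E3).prod 𝓘(ℝ, E3), B × B; 𝓘(ℝ, E3), B⟯) *ᵖ
    (TangentSpace 𝓘(ℝ, E3) : B → Type)

instance (p : B × B) : AddCommGroup (SourceTangent B p) :=
  inferInstanceAs (AddCommGroup (TangentSpace 𝓘(ℝ, E3) p.1))

instance (p : B × B) : AddCommGroup (TargetTangent B p) :=
  inferInstanceAs (AddCommGroup (TangentSpace 𝓘(ℝ, E3) p.2))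

instance (p : B × B) : IsTopologicalAddGroup (SourceTangent B p) :=
  inferInstanceAs (IsTopologicalAddGroup (TangentSpace 𝓘(ℝ, E3) p.1))

instance (p : B × B) : IsTopologicalAddGroup (TargetTangent B p) :=
  inferInstanceAs (IsTopologicalAddGroup (TangentSpace 𝓘(ℝ, E3) p.2))

instance (p : B × B) : ContinuousSMul ℝ (SourceTangent B p) :=
  inferInstanceAs (ContinuousSMul ℝ (TangentSpace 𝓘(ℝ, E3) p.1))

instance (p : B × B) : ContinuousSMul ℝ (TargetTangent B p) :=
  inferInstanceAs (ContinuousSMul ℝ (TangentSpace 𝓘(ℝ, E3) p.2))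

/-- The manifold of all linear maps `T_x B → T_y B`, `x y : B`: the total space of the vector
bundle over `B × B` with fibre `L(T_x B, T_y B)` at `(x, y)`. -/
abbrev HomTotal : Type _ :=
  Bundle.TotalSpace (E3 →L[ℝ] E3) fun p : B × B ↦ SourceTangent B p →L[ℝ] TargetTangent B p

theorem isOpen_invertible : IsOpen {p : HomTotal B | p.2.IsInvertible} := by
  rw [isOpen_iff_mem_nhds]
  intro p₀ hp₀
  set e := trivializationAt (E3 →L[ℝ] E3)
    (fun p : B × B ↦ SourceTangent B p →L[ℝ] TargetTangent B p) p₀.1 with he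
  have hs : p₀ ∈ e.source := FiberBundle.mem_trivializationAt_proj_source
  have key : ∀ p ∈ e.source, ((e p).2.IsInvertible ↔ p.2.IsInvertible) := by
    intro p hp
    have hp' := hp
    rw [he, hom_trivializationAt_source] at hp'
    have h2 : (e p).2 = ContinuousLinearMap.inCoordinates E3 (SourceTangent B) E3
        (TargetTangent B) p₀.1 p.1 p₀.1 p.1 p.2 := rfl
    rw [h2, ContinuousLinearMap.inCoordinates_eq hp'.1 hp'.2]
    simp
  have hopen : IsOpen {A : E3 →L[ℝ] E3 | A.IsInvertible} :=
    ContinuousLinearEquiv.isOpen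
  have hc : ContinuousAt (fun p ↦ (e p).2) p₀ :=
    (e.continuousAt hs).snd
  filter_upwards [hc (hopen.mem_nhds ((key p₀ hs).2 hp₀)), e.open_source.mem_nhds hs] with p h1 h2
  exact (key p h2).1 h1

/-- The manifold `Π¹(B, B)` of 1-jets of local diffeomorphisms of `B`, that is, of all linear
isomorphisms `T_x B → T_y B`, `x y : B`. It is an open submanifold of the total space of the bundle
of all linear maps; its charts are the usual coordinates `(xⁱ, yʲ, yʲᵢ)`. -/
abbrev OneJet : Type _ :=
  (⟨{p : HomTotal B | p.2.IsInvertible}, isOpen_invertible B⟩ : TopologicalSpace.Opens (HomTotal B))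

/-- The model of `Π¹(B, B)`: the coordinates take values in `(ℝ³ × ℝ³) × L(ℝ³, ℝ³)`. -/
abbrev jetModel : ModelWithCorners ℝ ((E3 × E3) × (E3 →L[ℝ] E3))
    (ModelProd (ModelProd E3 E3) (E3 →L[ℝ] E3)) :=
  (𝓘(ℝ, E3).prod 𝓘(ℝ, E3)).prod 𝓘(ℝ, E3 →L[ℝ] E3)

end OneJets

section Isotropy

variable {B : Type*} [TopologicalSpace B] [ChartedSpace E3 B] [IsManifold 𝓘(ℝ, E3) ∞ B]

/-- The linear isomorphism `L : T_x B → T_y B` as an element of `Π¹(B, B)`. -/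
def jet {x y : B} (L : TangentSpace 𝓘(ℝ, E3) x ≃L[ℝ] TangentSpace 𝓘(ℝ, E3) y) : OneJet B :=
  ⟨⟨(x, y), (L : TangentSpace 𝓘(ℝ, E3) x →L[ℝ] TangentSpace 𝓘(ℝ, E3) y)⟩, ⟨L, rfl⟩⟩

/-- The isotropy group `Π¹(B, B)_X^X` of the 1-jets with source and target `X`, that is, the linear
automorphisms of `T_X B`. -/
def Isotropy (X : B) : Type :=
  TangentSpace 𝓘(ℝ, E3) X ≃L[ℝ] TangentSpace 𝓘(ℝ, E3) X

/-- The group law is the composition of jets: `f * g = f ∘ g`. -/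
instance (X : B) : Group (Isotropy X) :=
  inferInstanceAs (Group (TangentSpace 𝓘(ℝ, E3) X ≃L[ℝ] TangentSpace 𝓘(ℝ, E3) X))

/-- The isotropy group carries the topology of a subspace of `Π¹(B, B)`. -/
instance (X : B) : TopologicalSpace (Isotropy X) :=
  TopologicalSpace.induced (fun P : Isotropy X ↦ jet (x := X) (y := X) P) inferInstance

/-- The coordinates `yʲᵢ` on the isotropy group, with respect to the preferred chart at `X`
(through which Mathlib identifies `T_X B` with `ℝ³`). -/
def Isotropy.coord {X : B} (P : Isotropy X) : E3 →L[ℝ] E3 :=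
  ContinuousLinearEquiv.toContinuousLinearMap
    (show TangentSpace 𝓘(ℝ, E3) X ≃L[ℝ] TangentSpace 𝓘(ℝ, E3) X from P)

theorem Isotropy.isOpenEmbedding_coord (X : B) :
    Topology.IsOpenEmbedding (Isotropy.coord : Isotropy X → (E3 →L[ℝ] E3)) := by
  have h1 : Topology.IsInducing (fun P : Isotropy X ↦ (jet (x := X) (y := X) P)) := ⟨rfl⟩
  have h2 : Topology.IsInducing (fun P : Isotropy X ↦ ((jet (x := X) (y := X) P : OneJet B) : HomTotal B)) :=
    Topology.IsInducing.subtypeVal.comp h1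
  have h3 := FiberBundle.totalSpaceMk_isInducing (E3 →L[ℝ] E3)
    (fun p : B × B ↦ SourceTangent B p →L[ℝ] TargetTangent B p) (X, X)
  have h4 : Topology.IsInducing (Isotropy.coord : Isotropy X → (E3 →L[ℝ] E3)) := by
    have := (Topology.IsInducing.of_comp_iff (f := (Isotropy.coord : Isotropy X → (E3 →L[ℝ] E3))) h3).1 h2
    exact this
  refine ⟨⟨h4, fun P Q h ↦ ?_⟩, ?_⟩
  · exact ContinuousLinearEquiv.coe_injective h
  · have hr : Set.range (Isotropy.coord : Isotropy X → (E3 →L[ℝ] E3)) =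
        Set.range ((↑) : (E3 ≃L[ℝ] E3) → E3 →L[ℝ] E3) := rfl
    rw [hr]
    exact ContinuousLinearEquiv.isOpen

/-- The smooth structure of the isotropy group, given by the global chart `yʲᵢ`. -/
instance (X : B) : ChartedSpace (E3 →L[ℝ] E3) (Isotropy X) :=
  (Isotropy.isOpenEmbedding_coord X).singletonChartedSpace

end Isotropy

section LieSubgroups

variable (E : Type*) [NormedAddCommGroup E] [NormedSpace ℝ E] {M : Type*} [TopologicalSpace M]
  [ChartedSpace E M] [Group M]

/-- A subgroup `S` of a Lie group modelled on `E` is a Lie subgroup if the subspace topology of `S` carries a smooth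
atlas for which `S` is a Lie group and the inclusion a smooth embedding. -/
def IsLieSubgroup (S : Subgroup M) : Prop :=
  ∃ (k : ℕ) (_ : ChartedSpace (EuclideanSpace ℝ (Fin k)) S),
    LieGroup 𝓘(ℝ, EuclideanSpace ℝ (Fin k)) ∞ S ∧
    Manifold.IsSmoothEmbedding 𝓘(ℝ, EuclideanSpace ℝ (Fin k)) 𝓘(ℝ, E) ∞ (Subtype.val : S → M)

end LieSubgroups

section Material

variable {B : Type*} [TopologicalSpace B] [ChartedSpace E3 B] [IsManifold 𝓘(ℝ, E3) ∞ B]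
  {V : Type*} [NormedAddCommGroup V] [NormedSpace ℝ V]

/-- A configuration of the body `B` is a smooth embedding `B → ℝ³`. -/
def IsConfiguration (φ : B → E3) : Prop :=
  Manifold.IsSmoothEmbedding 𝓘(ℝ, E3) 𝓘(ℝ, E3) ∞ φ

/-- A mechanical response of a simple body with reference configuration `φ₀` is a differentiable map
`W : Π¹(B, B) → V` that does not depend on the final point with respect to `φ₀`: its value does not
change when a jet with target `Y` is composed with the jet at `Y` of `φ₀⁻¹ ∘ τ ∘ φ₀`, where `τ` is
the translation of `ℝ³` by `φ₀ Z - φ₀ Y`. On tangent spaces this composition takes `L` to the `L'`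
with `dφ₀(Z) ∘ L' = dφ₀(Y) ∘ L`. -/
structure IsMechanicalResponse (φ₀ : B → E3) (W : OneJet B → V) : Prop where
  differentiable : MDifferentiable jetModel 𝓘(ℝ, V) W
  translation_invariant : ∀ (X Y Z : B)
    (L : TangentSpace 𝓘(ℝ, E3) X ≃L[ℝ] TangentSpace 𝓘(ℝ, E3) Y)
    (L' : TangentSpace 𝓘(ℝ, E3) X ≃L[ℝ] TangentSpace 𝓘(ℝ, E3) Z),
    (∀ v, (mfderiv 𝓘(ℝ, E3) 𝓘(ℝ, E3) φ₀ Z (L' v) : E3) =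
      mfderiv 𝓘(ℝ, E3) 𝓘(ℝ, E3) φ₀ Y (L v)) →
    W (jet L) = W (jet L')

/-- `P : T_X B → T_Y B` is a material isomorphism if `W (F · P) = W F` for every 1-jet `F` with
source `Y`. -/
def IsMaterialIso (W : OneJet B → V) {X Y : B}
    (P : TangentSpace 𝓘(ℝ, E3) X ≃L[ℝ] TangentSpace 𝓘(ℝ, E3) Y) : Prop :=
  ∀ (Z : B) (F : TangentSpace 𝓘(ℝ, E3) Y ≃L[ℝ] TangentSpace 𝓘(ℝ, E3) Z),
    W (jet (P.trans F)) = W (jet F)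

/-- The group of material symmetries at `X`, the material isomorphisms from `X` to `X`, as a
subgroup of the isotropy group at `X`. -/
def materialSymmetries (W : OneJet B → V) (X : B) : Subgroup (Isotropy X) where
  carrier := {P | IsMaterialIso W (X := X) (Y := X) P}
  one_mem' := fun _ _ ↦ rfl
  mul_mem' := fun {P Q} hP hQ Z F ↦ (hQ Z (ContinuousLinearEquiv.trans P F)).trans (hP Z F)
  inv_mem' := fun {P} hP Z F ↦ by
    have h := hP Z (ContinuousLinearEquiv.trans (ContinuousLinearEquiv.symm P) F)
    have e : ContinuousLinearEquiv.trans P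
        (ContinuousLinearEquiv.trans (ContinuousLinearEquiv.symm P) F) = F := by
      ext v
      exact congrArg F (ContinuousLinearEquiv.symm_apply_apply P v)
    rw [e] at h
    exact h.symm

end Material

end SimpleBody

end

open scoped Manifold ContDiff Topology Bundle

noncomputable section

/-! ### Closed subgroups of the unit group of a real Banach algebra, straightened near `1`. -/

namespace ClosedUnitSubgroup

open Filter NormedSpace

variable {A : Type*} [NormedRing A] [NormedAlgebra ℝ A] [CompleteSpace A]

/-! The symmetries are cut out by the equations `W(F ∘ P) = W(F)`, both sides continuous in `P`, so
they form a closed subgroup. The coordinates `yʲᵢ` identify the isotropy group with the units of the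
algebra `L(ℝ³, ℝ³)`, so what remains is Cartan's closed subgroup theorem for the units of a
finite-dimensional algebra. Limits of secants of `S` at `1` generate one-parameter subgroups of `S`
(`expUnit_smul_mem_of_tendsto`). Hence these generators form a linear space `lieAlg`, and near `1`
the group `S` meets `1 + V`, with `V` a complement, only in `1` (`eventually_eq_zero_of_disjoint`).
So the inverse of `h + v ↦ exp h * (1 + v)` flattens `S` near `1` (`exists_slice_chart`). Left
translations carry this chart along `S`; the slices make `S` an embedded submanifold, to which the
group operations restrict smoothly. -/

theorem exp_mul_exp_of_commute {a b : A} (h : Commute a b) : exp (a + b) = exp a * exp b :=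
  letI : NormedAlgebra ℚ A := NormedAlgebra.restrictScalars ℚ ℝ A
  exp_add_of_commute h

theorem exp_nsmul_eq_pow (n : ℕ) (a : A) : exp (n • a) = exp a ^ n :=
  letI : NormedAlgebra ℚ A := NormedAlgebra.restrictScalars ℚ ℝ A
  exp_nsmul n a

theorem contDiff_exp {n : ℕ∞ω} : ContDiff ℝ n (exp : A → A) :=
  contDiff_iff_contDiffAt.2 fun x ↦ (exp_analytic (𝕂 := ℝ) x).contDiffAt

theorem tendsto_exp {α : Type*} {l : Filter α} {f : α → A} {a : A} (h : Tendsto f l (𝓝 a)) :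
    Tendsto (fun i ↦ exp (f i)) l (𝓝 (exp a)) :=
  ((contDiff_exp (A := A) (n := 0)).continuous.tendsto a).comp h

/-- The exponential as a map to the group of units. -/
def expUnit (a : A) : Aˣ where
  val := exp a
  inv := exp (-a)
  val_inv := by
    rw [← exp_mul_exp_of_commute (Commute.refl a).neg_right, add_neg_cancel, exp_zero]
  inv_val := by
    rw [← exp_mul_exp_of_commute (Commute.refl a).neg_left, neg_add_cancel, exp_zero]

@[simp] theorem val_expUnit (a : A) : (expUnit a : A) = exp a := rfl

theorem expUnit_zero : expUnit (0 : A) = 1 := Units.ext exp_zero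

theorem expUnit_neg (a : A) : expUnit (-a) = (expUnit a)⁻¹ := Units.ext rfl

/-- A tangent vector at `1` of a closed subgroup of the units, in the sense of sequences of
secants, generates a one-parameter subgroup. -/
theorem expUnit_smul_mem_of_tendsto {S : Subgroup Aˣ} (hS : IsClosed (S : Set Aˣ)) {g : ℕ → Aˣ}
    (hg : ∀ n, g n ∈ S) {t : ℕ → ℝ} (ht : ∀ n, 0 < t n) (ht0 : Tendsto t atTop (𝓝 0)) {a : A}
    (ha : Tendsto (fun n ↦ (t n)⁻¹ • ((g n : A) - 1)) atTop (𝓝 a)) (r : ℝ) :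
    expUnit (r • a) ∈ S := by
  have hexp : HasStrictFDerivAt (exp : A → A)
      ((ContinuousLinearEquiv.refl ℝ A : A ≃L[ℝ] A) : A →L[ℝ] A) 0 :=
    hasStrictFDerivAt_exp_zero
  set l : A → A := hexp.localInverse _ _ _
  have hl' : HasFDerivAt l (1 : A →L[ℝ] A) 1 := by
    have := hexp.to_localInverse.hasFDerivAt
    rw [exp_zero] at this
    exact this
  have hl1 : l 1 = 0 := by
    have := hexp.localInverse_apply_image
    rwa [exp_zero] at this
  have hright : ∀ᶠ x in 𝓝 (1 : A), exp (l x) = x := by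
    have := hexp.eventually_right_inverse
    rwa [exp_zero] at this
  have hg1 : Tendsto (fun n ↦ (g n : A)) atTop (𝓝 1) := by
    have h := (ht0.smul ha).add_const 1
    simp only [zero_smul, zero_add] at h
    refine h.congr fun n ↦ ?_
    rw [smul_smul, mul_inv_cancel₀ (ht n).ne', one_smul, sub_add_cancel]
  have htinv : Tendsto (fun n ↦ (t n)⁻¹) atTop atTop :=
    (tendsto_nhdsWithin_iff.2 ⟨ht0, Eventually.of_forall ht⟩).inv_tendsto_nhdsGT_zero
  -- The local logarithm `l` has derivative `1` at `1`, so it does not change the limit of the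
  -- secants.
  have hlim : Tendsto (fun n ↦ (t n)⁻¹ • l (g n)) atTop (𝓝 a) := by
    have h := hl'.hasFDerivWithinAt (s := Set.univ) |>.lim (d := fun n ↦ (g n : A) - 1)
      (by simpa using hg1.sub_const 1) (by simp) ha
    simpa [hl1] using h
  have main : ∀ r : ℝ, 0 ≤ r → expUnit (r • a) ∈ S := by
    intro r hr
    -- With `m = ⌊r / t n⌋`, the power `g n ^ m = exp (m • l (g n))` tends to `exp (r • a)`, and `S`
    -- is closed.
    have hm : Tendsto (fun n ↦ (⌊r * (t n)⁻¹⌋₊ : ℝ) * t n) atTop (𝓝 r) := by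
      have h := (tendsto_nat_floor_mul_div_atTop hr).comp htinv
      refine h.congr fun n ↦ ?_
      simp [div_eq_mul_inv]
    have h1 : Tendsto (fun n ↦ ⌊r * (t n)⁻¹⌋₊ • l (g n)) atTop (𝓝 (r • a)) := by
      refine (hm.smul hlim).congr fun n ↦ ?_
      rw [smul_smul, mul_assoc, mul_inv_cancel₀ (ht n).ne', mul_one, Nat.cast_smul_eq_nsmul]
    have h2 : Tendsto (fun n ↦ g n ^ ⌊r * (t n)⁻¹⌋₊) atTop (𝓝 (expUnit (r • a))) := by
      rw [Units.isOpenEmbedding_val.isEmbedding.tendsto_nhds_iff]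
      refine (tendsto_exp h1).congr' ?_
      filter_upwards [hg1.eventually hright] with n hn
      simp only [Function.comp_apply, Units.val_pow_eq_pow_val]
      rw [exp_nsmul_eq_pow, hn]
    exact hS.mem_of_tendsto h2 (Eventually.of_forall fun n ↦ S.pow_mem (hg n) _)
  rcases le_total 0 r with hr | hr
  · exact main r hr
  · have := S.inv_mem (main (-r) (neg_nonneg.2 hr))
    rwa [← expUnit_neg, ← neg_smul, neg_neg] at this

/-- The Lie algebra of a closed subgroup of the units: the generators of its one-parameter
subgroups. -/
def lieAlg (S : Subgroup Aˣ) (hS : IsClosed (S : Set Aˣ)) : Submodule ℝ A where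
  carrier := {a | ∀ r : ℝ, expUnit (r • a) ∈ S}
  zero_mem' r := by
    rw [smul_zero, expUnit_zero]
    exact S.one_mem
  smul_mem' c a ha r := by
    rw [smul_smul]
    exact ha _
  add_mem' {a b} ha hb := by
    have hlin (c : A) : HasDerivAt (fun t : ℝ ↦ exp (t • c)) c 0 := by
      have h1 : HasDerivAt (fun t : ℝ ↦ t • c) c 0 := by
        simpa using (hasDerivAt_id (0 : ℝ)).smul_const c
      have h0 : HasFDerivAt (exp : A → A) (1 : A →L[ℝ] A) ((0 : ℝ) • c) := by
        rw [zero_smul]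
        exact hasFDerivAt_exp_zero
      exact h0.comp_hasDerivAt (0 : ℝ) h1
    -- The curve `exp (t • a) * exp (t • b)` lies in `S` and has velocity `a + b` at `0`; its
    -- secants at `t = 1 / (n + 1)` suffice.
    have hd : HasDerivAt (fun t : ℝ ↦ exp (t • a) * exp (t • b)) (a + b) 0 := by
      have h := (hlin a).mul (hlin b)
      simp only [zero_smul, exp_zero, mul_one, one_mul] at h
      exact h
    have hpos : ∀ n : ℕ, (0 : ℝ) < 1 / ((n : ℝ) + 1) := fun n ↦ by positivity
    have ht0 := tendsto_one_div_add_atTop_nhds_zero_nat (𝕜 := ℝ)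
    refine fun r ↦ expUnit_smul_mem_of_tendsto hS
      (g := fun n ↦ expUnit ((1 / ((n : ℝ) + 1)) • a) * expUnit ((1 / ((n : ℝ) + 1)) • b))
      (fun n ↦ S.mul_mem (ha _) (hb _)) hpos ht0 ?_ r
    have h := (hasDerivAt_iff_tendsto_slope_zero.1 hd).comp
      (tendsto_nhdsWithin_iff.2 ⟨ht0, Eventually.of_forall fun n ↦ (hpos n).ne'⟩)
    simpa [Function.comp_def] using h

theorem expUnit_mem_of_mem_lieAlg {S : Subgroup Aˣ} {hS : IsClosed (S : Set Aˣ)} {a : A}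
    (ha : a ∈ lieAlg S hS) : expUnit a ∈ S := by
  simpa using ha 1

variable [FiniteDimensional ℝ A]

/-- Near `1`, a closed subgroup meets the translate `1 + V` of a complement `V` of its Lie algebra
only in `1`. -/
theorem eventually_eq_zero_of_disjoint {S : Subgroup Aˣ} (hS : IsClosed (S : Set Aˣ))
    {V : Submodule ℝ A} (hV : Disjoint (lieAlg S hS) V) :
    ∀ᶠ w in 𝓝 (0 : A), w ∈ V → ∀ s ∈ S, (s : A) = 1 + w → w = 0 := by
  have : ProperSpace A := FiniteDimensional.proper ℝ A
  by_contra hcon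
  obtain ⟨w, hw0, hw⟩ := exists_seq_forall_of_frequently (not_eventually.1 hcon)
  simp only [Classical.not_imp, not_forall] at hw
  choose hwV s hs hsw hne using hw
  have hpos : ∀ n, 0 < ‖w n‖ := fun n ↦ norm_pos_iff.2 (hne n)
  -- A limit of the normalised `w n` is a unit vector of `V`; being also a limit of secants of `S`,
  -- it lies in `lieAlg`.
  obtain ⟨a, ha, φ, hφ, hlim⟩ := (isCompact_sphere (0 : A) 1).tendsto_subseq
    (x := fun n ↦ ‖w n‖⁻¹ • w n) fun n ↦ by
      simp [norm_smul, (hpos n).ne']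
  have haS : a ∈ lieAlg S hS := by
    refine expUnit_smul_mem_of_tendsto hS (g := fun n ↦ s (φ n)) (fun n ↦ hs _)
      (t := fun n ↦ ‖w (φ n)‖) (fun n ↦ hpos _) ?_ ?_
    · simpa using (hw0.comp hφ.tendsto_atTop).norm
    · simpa [hsw, Function.comp_def] using hlim
  have haV : a ∈ V := by
    refine (Submodule.closed_of_finiteDimensional V).mem_of_tendsto hlim
      (Eventually.of_forall fun n ↦ V.smul_mem _ (hwV _))
  have : a = 0 := Submodule.disjoint_def.1 hV a haS haV
  simp [this] at ha

/-- A closed subgroup of the units is a slice of suitable smooth coordinates near `1`. -/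
theorem exists_slice_chart {S : Subgroup Aˣ} (hS : IsClosed (S : Set Aˣ)) :
    ∃ Θ : OpenPartialHomeomorph A A, 1 ∈ Θ.source ∧ ContDiffOn ℝ ∞ Θ Θ.source ∧
      ContDiffOn ℝ ∞ Θ.symm Θ.target ∧
      ∀ s : Aˣ, (s : A) ∈ Θ.source → (s ∈ S ↔ Θ s ∈ lieAlg S hS) := by
  obtain ⟨V, hV⟩ := Submodule.exists_isCompl (lieAlg S hS)
  set p : A →L[ℝ] A := LinearMap.toContinuousLinearMap ((lieAlg S hS).projection V hV)
  have hpmem (a : A) : p a ∈ lieAlg S hS :=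
    Submodule.projection_apply_mem hV a
  have hqmem (a : A) : a - p a ∈ V := by
    rw [← Submodule.projection_apply_eq_zero_iff hV]
    change p (a - p a) = 0
    rw [map_sub, sub_eq_zero]
    exact (Submodule.projection_apply_of_mem_left hV (hpmem a)).symm
  have hpid {a : A} (ha : a ∈ lieAlg S hS) : p a = a :=
    Submodule.projection_apply_of_mem_left hV ha
  set Ψ : A → A := fun a ↦ exp (p a) * (1 + (a - p a)) with hΨ
  -- The order is `ω` because `ContDiffAt` of order `∞` at one point need not hold at that order on
  -- a neighbourhood; `hev2` needs this for the inverse.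
  have hsm : ContDiff ℝ ω Ψ :=
    (contDiff_exp.comp p.contDiff).mul (contDiff_const.add (contDiff_id.sub p.contDiff))
  have hder : HasFDerivAt Ψ ((ContinuousLinearEquiv.refl ℝ A : A ≃L[ℝ] A) : A →L[ℝ] A) 0 := by
    have h1 : HasFDerivAt (exp : A → A) (1 : A →L[ℝ] A) (p 0) := by
      rw [map_zero]
      exact hasFDerivAt_exp_zero
    have h2 : HasFDerivAt (fun a ↦ 1 + (a - p a)) (1 - p) 0 :=
      ((hasFDerivAt_id _).sub p.hasFDerivAt).const_add 1
    refine ((h1.comp 0 p.hasFDerivAt).mul' h2).congr_fderiv ?_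
    ext a
    simp
  have hΨ0 : Ψ 0 = 1 := by simp [hΨ]
  set Φ := hsm.contDiffAt.toOpenPartialHomeomorph Ψ hder (by simp)
  have h0 : (0 : A) ∈ Φ.source := ContDiffAt.mem_toOpenPartialHomeomorph_source _ hder (by simp)
  have hinv : ContDiffAt ℝ ω Φ.symm 1 := by
    have := hsm.contDiffAt.to_localInverse hder (by simp)
    rw [hΨ0] at this
    exact this
  have hev : ∀ᶠ a in 𝓝 (0 : A), ∀ s ∈ S, (s : A) = Ψ a → a - p a = 0 := by
    have ht : Tendsto (fun a ↦ a - p a) (𝓝 0) (𝓝 0) := by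
      have : Continuous fun a ↦ a - p a := by fun_prop
      simpa using this.tendsto 0
    filter_upwards [ht.eventually (eventually_eq_zero_of_disjoint hS hV.disjoint)] with a ha s hs h
    -- If `Ψ a = s` is in `S`, then so is `exp (-p a) * s = 1 + (a - p a)`.
    refine ha (hqmem a) ((expUnit (p a))⁻¹ * s)
      (S.mul_mem (S.inv_mem (expUnit_mem_of_mem_lieAlg (hpmem a))) hs) ?_
    rw [Units.val_mul, h]
    simp only [hΨ]
    rw [← val_expUnit, Units.inv_mul_cancel_left]
  have hev2 : ∀ᶠ a in 𝓝 (0 : A), ContDiffAt ℝ ω Φ.symm (Ψ a) := by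
    have := hsm.continuous.tendsto 0
    rw [hΨ0] at this
    exact this.eventually (hinv.eventually (by simp))
  obtain ⟨U, hU, hUo, h0U⟩ := eventually_nhds_iff.1 (hev.and hev2)
  refine ⟨(Φ.restrOpen U hUo).symm, ?_, ?_, ?_, ?_⟩
  · have : (0 : A) ∈ (Φ.restrOpen U hUo).source := ⟨h0, h0U⟩
    have := (Φ.restrOpen U hUo).map_source this
    rw [← hΨ0]
    exact this
  · intro x hx
    have h1 := (Φ.restrOpen U hUo).map_target hx
    have h2 := (hU _ h1.2).2
    have h3 : Ψ ((Φ.restrOpen U hUo).symm x) = x := (Φ.restrOpen U hUo).right_inv hx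
    rw [h3] at h2
    exact (h2.of_le (by simp)).contDiffWithinAt
  · exact (hsm.of_le (by simp)).contDiffOn
  · intro s hs
    have h1 := (Φ.restrOpen U hUo).map_target hs
    have h3 : Ψ ((Φ.restrOpen U hUo).symm s) = s := (Φ.restrOpen U hUo).right_inv hs
    constructor
    · intro hsS
      have := (hU _ h1.2).1 s hsS h3.symm
      rw [sub_eq_zero.1 this]
      exact hpmem _
    · intro h
      have : s = expUnit ((Φ.restrOpen U hUo).symm s) := by
        apply Units.ext
        rw [val_expUnit]
        conv_lhs => rw [← h3]
        have hpp := hpid h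
        simp only [hΨ]
        rw [hpp]; simp
      rw [this]
      exact expUnit_mem_of_mem_lieAlg h

end ClosedUnitSubgroup

/-! ### Embedded submanifolds from slice charts. -/

namespace SliceSubmanifold

variable {E F G : Type*} [NormedAddCommGroup E] [NormedSpace ℝ E] [NormedAddCommGroup F]
  [NormedSpace ℝ F] [NormedAddCommGroup G] [NormedSpace ℝ G] (L : (E × F) ≃L[ℝ] G)
  {M : Type*} [TopologicalSpace M]

/-- `S` is the slice `{w = 0}` of the domain of `φ`, in the coordinates `L.symm ∘ φ = (u, w)`. -/
def IsSliceChart (φ : OpenPartialHomeomorph M G) (S : Set M) : Prop :=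
  ∀ y ∈ φ.source, (y ∈ S ↔ (L.symm (φ y)).2 = 0)

variable {L} {S : Set M} {φ : OpenPartialHomeomorph M G}

theorem IsSliceChart.apply_mk_fst (h : IsSliceChart L φ S) {y : M} (hy : y ∈ φ.source)
    (hyS : y ∈ S) : L ((L.symm (φ y)).1, 0) = φ y := by
  rw [← (h y hy).1 hyS, Prod.mk.eta, L.apply_symm_apply]

theorem IsSliceChart.symm_mem (h : IsSliceChart L φ S) {u : E} (hu : L (u, 0) ∈ φ.target) :
    φ.symm (L (u, 0)) ∈ S := by
  rw [h _ (φ.map_target hu), φ.right_inv hu, L.symm_apply_apply]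

open Classical in
/-- The chart of the subspace `S` given by a slice chart. -/
def sliceChart (h : IsSliceChart L φ S) (x : S) : OpenPartialHomeomorph S E where
  toFun y := (L.symm (φ y)).1
  -- The point `x` is only a default value off the target.
  invFun u := if hu : L (u, 0) ∈ φ.target then ⟨φ.symm (L (u, 0)), h.symm_mem hu⟩ else x
  source := Subtype.val ⁻¹' φ.source
  target := (fun u ↦ L (u, 0)) ⁻¹' φ.target
  map_source' y hy := by
    rw [Set.mem_preimage, h.apply_mk_fst hy y.2]
    exact φ.map_source hy
  map_target' u hu := by
    rw [dif_pos (show L (u, 0) ∈ φ.target from hu)]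
    exact φ.map_target hu
  left_inv' y hy := by
    have hy' := h.apply_mk_fst hy y.2
    rw [dif_pos (by rw [hy']; exact φ.map_source hy)]
    apply Subtype.ext
    simp only [hy']
    exact φ.left_inv hy
  right_inv' u hu := by
    rw [dif_pos (show L (u, 0) ∈ φ.target from hu)]
    simp only
    rw [φ.right_inv hu, L.symm_apply_apply]
  open_source := φ.open_source.preimage continuous_subtype_val
  open_target := φ.open_target.preimage (by fun_prop)
  continuousOn_toFun :=
    (continuous_fst.comp L.symm.continuous).comp_continuousOn
      (φ.continuousOn.comp continuous_subtype_val.continuousOn fun _ hy ↦ hy)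
  continuousOn_invFun := by
    rw [Topology.IsInducing.subtypeVal.continuousOn_iff]
    have : ContinuousOn (fun u : E ↦ φ.symm (L (u, 0))) ((fun u ↦ L (u, 0)) ⁻¹' φ.target) :=
      φ.continuousOn_symm.comp (by fun_prop) fun _ hu ↦ hu
    refine this.congr fun u hu ↦ ?_
    simp only [Function.comp_apply]
    rw [dif_pos (show L (u, 0) ∈ φ.target from hu)]

theorem sliceChart_apply (h : IsSliceChart L φ S) (x y : S) :
    sliceChart h x y = (L.symm (φ y)).1 := rfl

theorem sliceChart_symm_apply (h : IsSliceChart L φ S) (x : S) {u : E}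
    (hu : L (u, 0) ∈ φ.target) : ((sliceChart h x).symm u : M) = φ.symm (L (u, 0)) := by
  classical exact congrArg Subtype.val (dif_pos hu)

theorem sliceChart_target (h : IsSliceChart L φ S) (x : S) :
    (sliceChart h x).target = (fun u ↦ L (u, 0)) ⁻¹' φ.target := rfl

variable [ChartedSpace G M] {n : ℕ∞ω}

/-- The transition is the ambient one, `ψ ∘ φ⁻¹`, restricted to `w = 0` and projected to the `u`
coordinate. -/
theorem contDiffOn_sliceChart_trans {φ ψ : OpenPartialHomeomorph M G} (h : IsSliceChart L φ S)
    (h' : IsSliceChart L ψ S) (hφ : φ ∈ IsManifold.maximalAtlas 𝓘(ℝ, G) n M)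
    (hψ : ψ ∈ IsManifold.maximalAtlas 𝓘(ℝ, G) n M) (x y : S) :
    ContDiffOn ℝ n ((sliceChart h x).symm ≫ₕ sliceChart h' y)
      ((sliceChart h x).symm ≫ₕ sliceChart h' y).source := by
  have key : ContDiffOn ℝ n (φ.symm ≫ₕ ψ) (φ.symm ≫ₕ ψ).source := by
    have := ModelWithCorners.contDiffOn_extendCoordChange (I := 𝓘(ℝ, G)) hφ hψ
    simpa [OpenPartialHomeomorph.extend] using this
  have hmaps : ∀ u ∈ ((sliceChart h x).symm ≫ₕ sliceChart h' y).source,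
      L (u, 0) ∈ (φ.symm ≫ₕ ψ).source := by
    intro u hu
    rw [OpenPartialHomeomorph.trans_source] at hu ⊢
    have h1 : L (u, 0) ∈ φ.target := hu.1
    refine ⟨h1, ?_⟩
    have h2 : ((sliceChart h x).symm u : M) ∈ ψ.source := hu.2
    rwa [sliceChart_symm_apply h x h1] at h2
  have hL : ContDiff ℝ n fun u : E ↦ L (u, 0) :=
    L.contDiff.comp (contDiff_id.prodMk contDiff_const)
  refine ((contDiff_fst.comp L.symm.contDiff).comp_contDiffOn
    (key.comp hL.contDiffOn hmaps)).congr fun u hu ↦ ?_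
  simp only [OpenPartialHomeomorph.coe_trans, Function.comp_apply, sliceChart_apply]
  rw [sliceChart_symm_apply h x (hmaps u hu).1]

/-- A subspace that is covered by slice charts is an embedded submanifold. -/
theorem exists_chartedSpace_isSmoothEmbedding (φ : S → OpenPartialHomeomorph M G)
    (hslice : ∀ x, IsSliceChart L (φ x) S) (hmem : ∀ x : S, (x : M) ∈ (φ x).source)
    (hatlas : ∀ x, φ x ∈ IsManifold.maximalAtlas 𝓘(ℝ, G) n M) :
    ∃ _ : ChartedSpace E S, IsManifold 𝓘(ℝ, E) n S ∧
      Manifold.IsSmoothEmbedding 𝓘(ℝ, E) 𝓘(ℝ, G) n (Subtype.val : S → M) := by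
  let cs : ChartedSpace E S :=
    { atlas := Set.range fun x ↦ sliceChart (hslice x) x
      chartAt := fun x ↦ sliceChart (hslice x) x
      mem_chart_source := hmem
      chart_mem_atlas := fun x ↦ ⟨x, rfl⟩ }
  have hman : IsManifold 𝓘(ℝ, E) n S := by
    refine isManifold_of_contDiffOn _ _ _ ?_
    rintro _ _ ⟨x, rfl⟩ ⟨y, rfl⟩
    simpa using contDiffOn_sliceChart_trans (hslice x) (hslice y) (hatlas x) (hatlas y) x y
  refine ⟨cs, hman, ⟨?_, Topology.IsEmbedding.subtypeVal⟩⟩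
  -- In the charts `sliceChart` and `φ x` the inclusion reads `u ↦ L (u, 0)`.
  refine Manifold.IsImmersionOfComplement.isImmersion (F := F) fun x ↦
    Manifold.IsImmersionAtOfComplement.mk_of_charts L (sliceChart (hslice x) x) (φ x) (hmem x)
      (hmem x) (IsManifold.chart_mem_maximalAtlas x) (hatlas x) subset_rfl ?_
  intro u hu
  have hu' : L (u, 0) ∈ (φ x).target := by
    simpa [OpenPartialHomeomorph.extend, sliceChart_target] using hu
  simp only [OpenPartialHomeomorph.extend, Function.comp_apply]
  change φ x (((sliceChart (hslice x) x).symm u : S) : M) = _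
  rw [sliceChart_symm_apply _ _ hu', (φ x).right_inv hu']

end SliceSubmanifold

/-! ### The closed subgroup theorem. -/

namespace ClosedUnitSubgroup

/-- A subgroup that is an embedded submanifold of a Lie group is a Lie group. -/
theorem lieGroup_of_isSmoothEmbedding {E G : Type*} [NormedAddCommGroup E] [NormedSpace ℝ E]
    [NormedAddCommGroup G] [NormedSpace ℝ G] {M : Type*} [TopologicalSpace M] [ChartedSpace G M]
    [Group M] {n : ℕ∞ω} [LieGroup 𝓘(ℝ, G) n M] (S : Subgroup M) [ChartedSpace E S]
    [IsManifold 𝓘(ℝ, E) n S]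
    (h : Manifold.IsSmoothEmbedding 𝓘(ℝ, E) 𝓘(ℝ, G) n (Subtype.val : S → M)) :
    LieGroup 𝓘(ℝ, E) n S := by
  have := topologicalGroup_of_lieGroup 𝓘(ℝ, G) n (G := M)
  exact
    -- A continuous map into `S` is smooth once its composite with the immersion `S → M` is.
    { contMDiff_mul := (ContMDiff.iff_comp_isImmersion h.isImmersion).2 ⟨continuous_mul,
        (h.contMDiff.comp contMDiff_fst).mul (h.contMDiff.comp contMDiff_snd)⟩
      contMDiff_inv := (ContMDiff.iff_comp_isImmersion h.isImmersion).2 ⟨continuous_inv,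
        h.contMDiff.inv⟩ }

variable {A : Type*} [NormedRing A] [NormedAlgebra ℝ A] [FiniteDimensional ℝ A] [CompleteSpace A]
  {M : Type*} [TopologicalSpace M] [ChartedSpace A M] [Group M] [LieGroup 𝓘(ℝ, A) ∞ M]

/-- **Closed subgroup theorem** for Lie groups isomorphic to the group of units of a
finite-dimensional algebra. -/
theorem isLieSubgroup_of_isClosed (e : M ≃* Aˣ) (he : ContMDiff 𝓘(ℝ, A) 𝓘(ℝ, A) ∞ e)
    (he' : ContMDiff 𝓘(ℝ, A) 𝓘(ℝ, A) ∞ e.symm) {S : Subgroup M} (hS : IsClosed (S : Set M)) :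
    SimpleBody.IsLieSubgroup A S := by
  have := topologicalGroup_of_lieGroup 𝓘(ℝ, A) ∞ (G := M)
  have hT : IsClosed ((S.comap e.symm.toMonoidHom : Subgroup Aˣ) : Set Aˣ) :=
    hS.preimage he'.continuous
  obtain ⟨Θ, h1, hΘ, hΘ', hslice⟩ := exists_slice_chart hT
  set H := lieAlg _ hT
  obtain ⟨V, hV⟩ := Submodule.exists_isCompl H
  let b : EuclideanSpace ℝ (Fin (Module.finrank ℝ H)) ≃L[ℝ] H :=
    ContinuousLinearEquiv.ofFinrankEq (by simp)
  let L : (EuclideanSpace ℝ (Fin (Module.finrank ℝ H)) × V) ≃L[ℝ] A :=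
    (b.prodCongr (ContinuousLinearEquiv.refl ℝ V)).trans
      (H.prodEquivOfIsCompl V hV).toContinuousLinearEquiv
  have hL : ∀ a, (L.symm a).2 = 0 ↔ a ∈ H := by
    intro a
    exact Submodule.prodEquivOfIsCompl_symm_apply_snd_eq_zero _ _ hV
  let eh : M ≃ₜ Aˣ :=
    { e.toEquiv with
      continuous_toFun := he.continuous
      continuous_invFun := he'.continuous }
  let v : OpenPartialHomeomorph Aˣ A := Units.isOpenEmbedding_val.toOpenPartialHomeomorph _
  -- Translation by `s⁻¹` moves `s` to `1` and preserves `S`, so one chart at `1` serves every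
  -- point.
  let φ : S → OpenPartialHomeomorph M A := fun s ↦
    (Homeomorph.mulLeft (s : M)⁻¹).toOpenPartialHomeomorph ≫ₕ eh.toOpenPartialHomeomorph ≫ₕ v ≫ₕ Θ
  have hφ (s : S) (g : M) : φ s g = Θ (e ((s : M)⁻¹ * g) : Aˣ) := rfl
  have hφs (s : S) (g : M) : g ∈ (φ s).source ↔ ((e ((s : M)⁻¹ * g) : Aˣ) : A) ∈ Θ.source := by
    simp [φ, v, eh]
  have hsl (s : S) : SliceSubmanifold.IsSliceChart L (φ s) S := by
    intro g hg
    rw [hφs] at hg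
    rw [hL, hφ, ← hslice _ hg]
    simp [S.mul_mem_cancel_left (S.inv_mem s.2)]
  have hmem (s : S) : (s : M) ∈ (φ s).source := by
    rw [hφs]
    simpa using h1
  have hat (s : S) : φ s ∈ IsManifold.maximalAtlas 𝓘(ℝ, A) ∞ M := by
    apply OpenPartialHomeomorph.mem_maximalAtlas_of_contMDiffOn
    · refine hΘ.contMDiffOn.comp ((Units.contMDiff_val.comp
        (he.comp (contMDiff_mul_left (a := (s : M)⁻¹)))).contMDiffOn) fun g hg ↦ ?_
      exact (hφs s g).1 hg
    · have hv : ContMDiffOn 𝓘(ℝ, A) 𝓘(ℝ, A) ∞ v.symm v.target := by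
        exact contMDiffOn_symm_of_mem_maximalAtlas (IsManifold.chart_mem_maximalAtlas (1 : Aˣ))
      have hc : ContMDiff 𝓘(ℝ, A) 𝓘(ℝ, A) ∞ fun x : Aˣ ↦ ((s : M)⁻¹)⁻¹ * e.symm x :=
        contMDiff_const.mul he'
      refine hc.comp_contMDiffOn (hv.comp (hΘ'.contMDiffOn.mono ?_) ?_)
      · intro x hx
        simp only [φ, OpenPartialHomeomorph.trans_target] at hx
        exact hx.1.1.1
      · intro x hx
        simp only [φ, OpenPartialHomeomorph.trans_target] at hx
        simp_all
  obtain ⟨cs, hman, hemb⟩ :=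
    SliceSubmanifold.exists_chartedSpace_isSmoothEmbedding φ hsl hmem hat
  exact ⟨_, cs, lieGroup_of_isSmoothEmbedding S hemb, hemb⟩

end ClosedUnitSubgroup

/-! ### The isotropy group and its closed subgroup of material symmetries. -/

namespace SimpleBody

variable {B : Type*} [TopologicalSpace B] [ChartedSpace E3 B] [IsManifold 𝓘(ℝ, E3) ∞ B]

instance (X : B) : IsManifold 𝓘(ℝ, E3 →L[ℝ] E3) ∞ (Isotropy X) :=
  (Isotropy.isOpenEmbedding_coord X).isManifold_singleton

instance (X : B) : Nonempty (Isotropy X) := ⟨1⟩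

theorem Isotropy.contMDiff_coord (X : B) :
    ContMDiff 𝓘(ℝ, E3 →L[ℝ] E3) 𝓘(ℝ, E3 →L[ℝ] E3) ∞ (Isotropy.coord (X := X)) :=
  contMDiff_isOpenEmbedding (Isotropy.isOpenEmbedding_coord X)

/-- The isotropy group is the group of invertible matrices in the coordinates `yʲᵢ`. -/
def Isotropy.unitsEquiv (X : B) : Isotropy X ≃* (E3 →L[ℝ] E3)ˣ :=
  (ContinuousLinearEquiv.unitsEquiv ℝ E3).symm

theorem Isotropy.contMDiff_unitsEquiv (X : B) :
    ContMDiff 𝓘(ℝ, E3 →L[ℝ] E3) 𝓘(ℝ, E3 →L[ℝ] E3) ∞ (Isotropy.unitsEquiv X) :=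
  ContMDiff.of_comp_isOpenEmbedding Units.isOpenEmbedding_val (Isotropy.contMDiff_coord X)

theorem Isotropy.contMDiff_unitsEquiv_symm (X : B) :
    ContMDiff 𝓘(ℝ, E3 →L[ℝ] E3) 𝓘(ℝ, E3 →L[ℝ] E3) ∞ (Isotropy.unitsEquiv X).symm := by
  refine ContMDiff.of_comp_isOpenEmbedding (Isotropy.isOpenEmbedding_coord X) ?_
  have h : Isotropy.coord ∘ (Isotropy.unitsEquiv X).symm = Units.val := by
    ext1 u
    exact congrArg Units.val ((Isotropy.unitsEquiv X).apply_symm_apply u)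
  rw [h]
  exact Units.contMDiff_val

instance (X : B) : LieGroup 𝓘(ℝ, E3 →L[ℝ] E3) ∞ (Isotropy X) where
  contMDiff_mul := by
    have h : (fun p : Isotropy X × Isotropy X ↦ p.1 * p.2) = fun p ↦
        (Isotropy.unitsEquiv X).symm (Isotropy.unitsEquiv X p.1 * Isotropy.unitsEquiv X p.2) := by
      ext1 p
      rw [← map_mul, MulEquiv.symm_apply_apply]
    rw [h]
    exact (Isotropy.contMDiff_unitsEquiv_symm X).comp
      (((Isotropy.contMDiff_unitsEquiv X).comp contMDiff_fst).mul
        ((Isotropy.contMDiff_unitsEquiv X).comp contMDiff_snd))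
  contMDiff_inv := by
    have h : (fun p : Isotropy X ↦ p⁻¹) = fun p ↦
        (Isotropy.unitsEquiv X).symm (Isotropy.unitsEquiv X p)⁻¹ := by
      ext1 p
      rw [← map_inv, MulEquiv.symm_apply_apply]
    rw [h]
    exact (Isotropy.contMDiff_unitsEquiv_symm X).comp (Isotropy.contMDiff_unitsEquiv X).inv

/-- All these jets lie in the fibre over `(X, Z)`, whose inclusion into the total space is
continuous; there the map is `P ↦ F' ∘ P.coord`. -/
theorem continuous_jet_trans {X Z : B}
    (F : TangentSpace 𝓘(ℝ, E3) X ≃L[ℝ] TangentSpace 𝓘(ℝ, E3) Z) :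
    Continuous fun P : Isotropy X ↦ jet (ContinuousLinearEquiv.trans P F) := by
  have h := (FiberBundle.totalSpaceMk_isInducing (E3 →L[ℝ] E3)
    (fun p : B × B ↦ SourceTangent B p →L[ℝ] TargetTangent B p) (X, Z)).continuous
  refine Topology.IsInducing.subtypeVal.continuous_iff.2 ?_
  let F' : E3 →L[ℝ] E3 := (F : TangentSpace 𝓘(ℝ, E3) X →L[ℝ] TangentSpace 𝓘(ℝ, E3) Z)
  have h2 : Continuous fun P : Isotropy X ↦ F'.comp P.coord :=
    continuous_const.clm_comp (Isotropy.isOpenEmbedding_coord X).continuous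
  exact h.comp h2

theorem isClosed_materialSymmetries {V : Type*} [NormedAddCommGroup V] [NormedSpace ℝ V]
    {W : OneJet B → V} (hW : Continuous W) (X : B) :
    IsClosed (materialSymmetries W X : Set (Isotropy X)) := by
  have h : (materialSymmetries W X : Set (Isotropy X)) =
      ⋂ (Z : B) (F : TangentSpace 𝓘(ℝ, E3) X ≃L[ℝ] TangentSpace 𝓘(ℝ, E3) Z),
        {P : Isotropy X | W (jet (ContinuousLinearEquiv.trans P F)) = W (jet F)} := by
    ext P
    simp only [Set.mem_iInter]
    rfl
  rw [h]
  exact isClosed_iInter fun Z ↦ isClosed_iInter fun F ↦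
    isClosed_eq (hW.comp (continuous_jet_trans F)) continuous_const

end SimpleBody

end

theorem proposition21 {B : Type*} [TopologicalSpace B] [ChartedSpace SimpleBody.E3 B]
    [IsManifold 𝓘(ℝ, SimpleBody.E3) ∞ B] {V : Type*} [NormedAddCommGroup V] [NormedSpace ℝ V]
    (φ₀ : B → SimpleBody.E3) (hφ₀ : SimpleBody.IsConfiguration φ₀)
    (W : SimpleBody.OneJet B → V) (hW : SimpleBody.IsMechanicalResponse φ₀ W) (X : B) :
    LieGroup 𝓘(ℝ, SimpleBody.E3 →L[ℝ] SimpleBody.E3) ∞ (SimpleBody.Isotropy X) ∧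
    (∃ e : SimpleBody.Isotropy X ≃* (SimpleBody.E3 →L[ℝ] SimpleBody.E3)ˣ,
      ContMDiff 𝓘(ℝ, SimpleBody.E3 →L[ℝ] SimpleBody.E3)
        𝓘(ℝ, SimpleBody.E3 →L[ℝ] SimpleBody.E3) ∞ e ∧
      ContMDiff 𝓘(ℝ, SimpleBody.E3 →L[ℝ] SimpleBody.E3)
        𝓘(ℝ, SimpleBody.E3 →L[ℝ] SimpleBody.E3) ∞ e.symm) ∧
    IsClosed (SimpleBody.materialSymmetries W X : Set (SimpleBody.Isotropy X)) ∧
    SimpleBody.IsLieSubgroup (SimpleBody.E3 →L[ℝ] SimpleBody.E3)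
      (SimpleBody.materialSymmetries W X) := by
  have hc := SimpleBody.isClosed_materialSymmetries hW.differentiable.continuous X
  exact ⟨inferInstance, ⟨SimpleBody.Isotropy.unitsEquiv X,
    SimpleBody.Isotropy.contMDiff_unitsEquiv X, SimpleBody.Isotropy.contMDiff_unitsEquiv_symm X⟩,
    hc, ClosedUnitSubgroup.isLieSubgroup_of_isClosed _
      (SimpleBody.Isotropy.contMDiff_unitsEquiv X)
      (SimpleBody.Isotropy.contMDiff_unitsEquiv_symm X) hc⟩
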